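/- Let $d\ge 1$, let $\mathbb B_d$ be the open unit ball of $\mathbb C^d$, and let $\mathcal U(d)$ be the group of $d\times d$ unitary matrices. For a commuting $d$-tuple $T=(T_1,\dots,T_d)$ of bounded linear operators on a complex Hilbert space $\mathcal H$ and $u\in\mathcal U(d)$, put $(u\cdot T)_j=\sum_{k=1}^d u_{jk}T_k$. The tuple $T$ is called weakly $\mathcal U(d)$-homogeneous if for every $u\in\mathcal U(d)$ there is a bounded invertible operator $\Gamma(u)$ on $\mathcal H$ with $\Gamma(u)T_j=(u\cdot T)_j\Gamma(u)$ for $j=1,\dots,d$; it is called $\mathcal U(d)$-homogeneous if for every $u$ such a $\Gamma(u)$ can be chosen unitary. Commuting tuples $T$ on $\mathcal H$ and $R$ on $\mathcal K$ are similar if there is a bounded invertible operator $S:\mathcal H\to\mathcal K$ with $ST_j=R_jS$ for all $j$. Let $\mathscr H(\kappa)$ be a reproducing kernel Hilbert space of complex-valued holomorphic functions on $\mathbb B_d$. Suppose that $\mathscr H(\kappa)=\bigoplus_{n\in\mathbb N}\mathrm{Hom}(n)$, that is, $\mathscr H(\kappa)$ contains every space $\mathrm{Hom}(n)$ of homogeneous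 polynomials of degree $n$ in $z_1,\dots,z_d$ (restricted to $\mathbb B_d$) and is their orthogonal Hilbert space direct sum. Suppose also that the operators $\mathscr M_{z_j}f=z_jf$, $j=1,\dots,d$, are bounded on $\mathscr H(\kappa)$, and let $\mathscr M_z=(\mathscr M_{z_1},\dots,\mathscr M_{z_d})$. Then $\mathscr M_z$ is weakly $\mathcal U(d)$-homogeneous if and only if $\mathscr M_z$ is similar to a $\mathcal U(d)$-homogeneous tuple of operators on a Hilbert space. -/

import Mathlib

universe u

/-- The open unit ball `𝔹_d` of `ℂ^d` (Euclidean norm), as a type. -/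
abbrev UnitBall (d : ℕ) : Type :=
  ↥(Metric.ball (0 : EuclideanSpace ℂ (Fin d)) 1)

/-- A complex-valued function on the open unit ball of `ℂ^d` is holomorphic. -/
def IsHolomorphicOnBall {d : ℕ} (f : UnitBall d → ℂ) : Prop :=
  ∃ F : EuclideanSpace ℂ (Fin d) → ℂ,
    DifferentiableOn ℂ F (Metric.ball 0 1) ∧ ∀ z : UnitBall d, F z.1 = f z

/-- The value of a polynomial in `d` variables at a point of the ball. -/
noncomputable def polyVal {d : ℕ} (p : MvPolynomial (Fin d) ℂ) (z : UnitBall d) : ℂ :=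
  MvPolynomial.eval (fun i => z.1 i) p

section Tuples

variable {d : ℕ} {H : Type u} [NormedAddCommGroup H] [InnerProductSpace ℂ H]

/-- The tuple `u · T`, with `(u · T)_j = ∑_k u_{jk} T_k`. -/
noncomputable def unitaryAct (a : Matrix.unitaryGroup (Fin d) ℂ) (T : Fin d → H →L[ℂ] H) :
    Fin d → H →L[ℂ] H :=
  fun j => ∑ k, (a : Matrix (Fin d) (Fin d) ℂ) j k • T k

/-- Weakly `U(d)`-homogeneous tuples: commuting tuples such that for every unitary matrix `a` there
is a bounded invertible operator `Γ` with `Γ T_j = (a · T)_j Γ` for all `j`. -/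
def IsWeaklyHomogeneous (T : Fin d → H →L[ℂ] H) : Prop :=
  (∀ i j, Commute (T i) (T j)) ∧
    ∀ a : Matrix.unitaryGroup (Fin d) ℂ, ∃ Γ : H ≃L[ℂ] H,
      ∀ j (f : H), Γ (T j f) = unitaryAct a T j (Γ f)

/-- `U(d)`-homogeneous tuples: commuting tuples `T` such that `a · T` is unitarily equivalent to `T`
for every unitary matrix `a`. -/
def IsHomogeneous (T : Fin d → H →L[ℂ] H) : Prop :=
  (∀ i j, Commute (T i) (T j)) ∧
    ∀ a : Matrix.unitaryGroup (Fin d) ℂ, ∃ U : H ≃ₗᵢ[ℂ] H,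
      ∀ j (f : H), U (T j f) = unitaryAct a T j (U f)

/-- Similarity of tuples: a single bounded invertible operator intertwines all entries. -/
def IsSimilarTuple {K : Type u} [NormedAddCommGroup K] [InnerProductSpace ℂ K]
    (T : Fin d → H →L[ℂ] H) (R : Fin d → K →L[ℂ] K) : Prop :=
  ∃ S : H ≃L[ℂ] K, ∀ j (f : H), S (T j f) = R j (S f)

/-- `T` is similar to some `U(d)`-homogeneous tuple on a Hilbert space `K`. (Such a `K` is linearly
homeomorphic to `H`, so it is separable as soon as `H` is.) -/
def IsSimilarToHomogeneous (T : Fin d → H →L[ℂ] H) : Prop :=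
  ∃ (K : Type u) (_ : NormedAddCommGroup K) (_ : InnerProductSpace ℂ K) (_ : CompleteSpace K)
    (R : Fin d → K →L[ℂ] K), IsHomogeneous R ∧ IsSimilarTuple T R

end Tuples

section FunctionSpace

variable (d : ℕ) (H : Type u) [NormedAddCommGroup H] [InnerProductSpace ℂ H]
  [RKHS ℂ H (UnitBall d) ℂ]

/-- The elements of `H` that are (restrictions to the ball of) homogeneous polynomials of
degree `n`. -/
def homSubspace (n : ℕ) : Submodule ℂ H where
  carrier := {f | ∃ p : MvPolynomial (Fin d) ℂ, p.IsHomogeneous n ∧ ∀ z, f z = polyVal p z}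
  zero_mem' := ⟨0, MvPolynomial.isHomogeneous_zero _ _ _, fun z => by simp [polyVal]⟩
  add_mem' := by
    rintro f g ⟨p, hp, hf⟩ ⟨q, hq, hg⟩
    exact ⟨p + q, hp.add hq, fun z => by simp [polyVal, hf z, hg z]⟩
  smul_mem' := by
    rintro c f ⟨p, hp, hf⟩
    refine ⟨c • p, (MvPolynomial.homogeneousSubmodule (Fin d) ℂ n).smul_mem c hp, fun z => ?_⟩
    simp [polyVal, hf z]

/-- The orthogonal decomposition `H = ⨁_n Hom(n)`: all homogeneous polynomials belong to `H`, and
`H` is the Hilbert space direct sum of the subspaces `Hom(n)`. -/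
structure HasHomDecomposition [CompleteSpace H] : Prop where
  exists_of_isHomogeneous : ∀ (n : ℕ) (p : MvPolynomial (Fin d) ℂ), p.IsHomogeneous n →
    ∃ f : H, ∀ z, f z = polyVal p z
  isHilbertSum : IsHilbertSum ℂ (fun n => homSubspace d H n)
    (fun n => (homSubspace d H n).subtypeₗᵢ)

/-- `z_j f ∈ H` for all `f ∈ H` and all `j`; by the closed graph theorem this says that the
multiplication operators by the coordinate functions are bounded operators on `H`. -/
def CoordInvariant : Prop :=
  ∀ (j : Fin d) (f : H), ∃ g : H, ∀ z : UnitBall d, g z = z.1 j * f z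

variable {d H}

/-- The function `z_j f`, as an element of `H`. -/
noncomputable def coordMulFun (h : CoordInvariant d H) (j : Fin d) (f : H) : H :=
  Classical.choose (h j f)

theorem coordMulFun_apply (h : CoordInvariant d H) (j : Fin d) (f : H) (z : UnitBall d) :
    coordMulFun h j f z = z.1 j * f z :=
  Classical.choose_spec (h j f) z

/-- Multiplication by the coordinate function `z_j`, as a linear map. -/
noncomputable def coordMulLinear (h : CoordInvariant d H) (j : Fin d) : H →ₗ[ℂ] H where
  toFun := coordMulFun h j
  map_add' f g := by
    refine RKHS.ext fun z => ?_
    simp [coordMulFun_apply, mul_add]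
  map_smul' c f := by
    refine RKHS.ext fun z => ?_
    simp [coordMulFun_apply, mul_left_comm]

theorem coordMulLinear_apply (h : CoordInvariant d H) (j : Fin d) (f : H) (z : UnitBall d) :
    coordMulLinear h j f z = z.1 j * f z :=
  coordMulFun_apply h j f z

/-- The tuple `M_z = (M_{z_1}, …, M_{z_d})` of bounded operators of multiplication by the
coordinate functions. -/
noncomputable def coordMul [CompleteSpace H] (h : CoordInvariant d H) (j : Fin d) : H →L[ℂ] H :=
  ContinuousLinearMap.ofSeqClosedGraph (g := coordMulLinear h j) (by
    intro s x y hs hy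
    refine RKHS.ext fun z => ?_
    have hc : Continuous fun f : H => f z :=
      (continuous_apply z).comp (RKHS.coeCLM ℂ (H := H)).continuous
    have h1 := (hc.tendsto y).comp hy
    have h2 := ((hc.tendsto x).comp hs).const_mul (z.1 j)
    refine tendsto_nhds_unique h1 ?_
    rw [coordMulLinear_apply]
    refine h2.congr fun n => ?_
    simp [coordMulLinear_apply])

theorem coordMul_apply [CompleteSpace H] (h : CoordInvariant d H) (j : Fin d) (f : H)
    (z : UnitBall d) : coordMul h j f z = z.1 j * f z :=
  coordMulLinear_apply h j f z

end FunctionSpace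

/-! Weak homogeneity forces the substitutions `p ↦ p ∘ a` to be bounded. An intertwiner satisfies `Γ
p = (p ∘ a) · Γ 1` (`intertwiner_polyElem_apply`) and `(Γ 1)(0) ≠ 0`. For `p` homogeneous, pairing
`Γ p` with `p ∘ a` sees only the constant term of `Γ 1`, so `‖p ∘ a‖ ≤ (‖Γ‖ / |(Γ 1)(0)|) ‖p‖` in
every degree at once, and orthogonality of the degrees gives all `p`. Baire category and compactness
of the unitary group make the bound uniform in `a` (`exists_uniform_bound_linearSubst`). The
extended operators `C a` intertwine `M_z` with `a · M_z`, and Haar averaging of the norm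
(`exists_equiv_forall_norm_eq`) makes them unitary. The converse is conjugation by the similarity.
-/

open MeasureTheory in
-- Weyl's unitarian trick: the new norm is the `L²` norm of the orbit map `a ↦ C a f` for Haar
-- measure, and `K` is the space of orbit maps.
theorem exists_equiv_forall_norm_eq {G : Type} [Group G] [TopologicalSpace G] [IsTopologicalGroup G]
    [CompactSpace G] [SecondCountableTopology G] {H : Type u} [NormedAddCommGroup H]
    [InnerProductSpace ℂ H] [CompleteSpace H] (C : G → H →L[ℂ] H)
    (hmul : ∀ a b f, C a (C b f) = C (b * a) f) (hone : ∀ f, C 1 f = f)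
    (hcont : ∀ f, Continuous fun a => C a f) {M : ℝ} (hM : ∀ a f, ‖C a f‖ ≤ M * ‖f‖) :
    ∃ (K : Type u) (_ : NormedAddCommGroup K) (_ : InnerProductSpace ℂ K) (_ : CompleteSpace K)
      (S : H ≃L[ℂ] K), ∀ a f, ‖S (C a f)‖ = ‖S f‖ := by
  let _ : MeasurableSpace G := borel G
  have : BorelSpace G := ⟨rfl⟩
  let μ : Measure G := Measure.haarMeasure ⊤
  have : IsProbabilityMeasure μ := ⟨Measure.haarMeasure_self⟩
  let F : H →ₗ[ℂ] C(G, H) :=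
    { toFun := fun f => ⟨fun a => C a f, hcont f⟩
      map_add' := fun f g => by ext a; simp
      map_smul' := fun c f => by ext a; simp }
  have hFb : ∀ f, ‖F f‖ ≤ M * ‖f‖ := fun f => by
    refine (ContinuousMap.norm_le _ ?_).2 fun a => hM a f
    exact (norm_nonneg _).trans (hM 1 f)
  let V : H →L[ℂ] Lp H 2 μ := (ContinuousMap.toLp 2 μ ℂ).comp (F.mkContinuous M hFb)
  have hV : ∀ f, ‖V f‖ = (eLpNorm (fun a => C a f) 2 μ).toReal := fun f => by
    rw [Lp.norm_def]
    congr 1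
    exact eLpNorm_congr_ae (ContinuousMap.coeFn_toLp μ (𝕜 := ℂ) (F f))
  have hmem : ∀ f, MemLp (fun a => C a f) 2 μ := fun f =>
    (memLp_congr_ae (ContinuousMap.coeFn_toLp μ (𝕜 := ℂ) (F f))).1 (Lp.memLp (V f))
  have hinv : ∀ a f, ‖V (C a f)‖ = ‖V f‖ := fun a f => by
    rw [hV, hV]
    congr 1
    -- Since `C` reverses products, the orbit map of `C a f` is a left translate of that of `f`.
    have := eLpNorm_comp_measurePreserving (p := 2) (hmem f).1 (measurePreserving_mul_left μ a)
    rw [← this]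
    congr 1
    ext b
    exact hmul b a f
  have hlow : ∀ f, ‖f‖ ≤ M.toNNReal * ‖V f‖ := fun f => by
    have h1 : eLpNorm (fun _ : G => f) 2 μ ≤ M.toNNReal * eLpNorm (fun a => C a f) 2 μ := by
      refine eLpNorm_le_nnreal_smul_eLpNorm_of_ae_le_mul (Filter.Eventually.of_forall fun a => ?_) 2
      rw [← NNReal.coe_le_coe]
      -- The upper bound at `a⁻¹` is a lower bound at `a`, which makes `V` bounded below with closed
      -- range.
      have := hM a⁻¹ (C a f)
      rw [hmul, mul_inv_cancel, hone] at this
      refine this.trans ?_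
      simp only [NNReal.coe_mul, coe_nnnorm, Real.coe_toNNReal']
      gcongr
      exact le_max_left _ _
    have h2 : eLpNorm (fun _ : G => f) 2 μ = ‖f‖ₑ := by
      rw [eLpNorm_const _ (by simp) (NeZero.ne μ)]
      simp
    rw [h2] at h1
    have h3 := ENNReal.toReal_mono (ENNReal.mul_ne_top (by simp) (hmem f).2.ne) h1
    rw [ENNReal.toReal_mul, ← hV] at h3
    simpa using h3
  have hanti : AntilipschitzWith M.toNNReal V := AddMonoidHomClass.antilipschitz_of_bound V hlow
  let K := LinearMap.range (V : H →ₗ[ℂ] Lp H 2 μ)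
  have hcl : IsClosed (Set.range V) := hanti.isClosed_range V.uniformContinuous
  have : CompleteSpace K := IsClosed.completeSpace_coe (hs := hcl)
  let S : H ≃L[ℂ] K := V.equivRange hanti.injective hcl
  exact ⟨K, inferInstance, inferInstance, inferInstance, S, fun a f => hinv a f⟩

/-! ### Linear substitutions in polynomials -/

section LinearChange

variable {d : ℕ}

/-- The linear substitution `p ↦ p ∘ a`, for a matrix `a`. -/
noncomputable def linearSubst (a : Matrix (Fin d) (Fin d) ℂ) :
    MvPolynomial (Fin d) ℂ →ₐ[ℂ] MvPolynomial (Fin d) ℂ :=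
  MvPolynomial.aeval fun j => ∑ k, MvPolynomial.C (a j k) * MvPolynomial.X k

theorem linearSubst_X (a : Matrix (Fin d) (Fin d) ℂ) (j : Fin d) :
    linearSubst a (MvPolynomial.X j) = ∑ k, MvPolynomial.C (a j k) * MvPolynomial.X k := by
  simp [linearSubst]

theorem linearSubst_isHomogeneous (a : Matrix (Fin d) (Fin d) ℂ) {n : ℕ}
    {p : MvPolynomial (Fin d) ℂ} (hp : p.IsHomogeneous n) : (linearSubst a p).IsHomogeneous n := by
  have := hp.aeval (S := ℂ) (n := 1)
    (fun j => ∑ k, MvPolynomial.C (a j k) * MvPolynomial.X k : Fin d → MvPolynomial (Fin d) ℂ)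
    fun j => MvPolynomial.IsHomogeneous.sum _ _ _ fun k _ => MvPolynomial.isHomogeneous_C_mul_X _ _
  rwa [one_mul] at this

theorem linearSubst_linearSubst (a b : Matrix (Fin d) (Fin d) ℂ) (p : MvPolynomial (Fin d) ℂ) :
    linearSubst a (linearSubst b p) = linearSubst (b * a) p := by
  suffices (linearSubst a).comp (linearSubst b) = linearSubst (b * a) from
    DFunLike.congr_fun this p
  refine MvPolynomial.algHom_ext fun j => ?_
  simp only [AlgHom.comp_apply, linearSubst_X, map_sum, map_mul, MvPolynomial.algHom_C,
    MvPolynomial.algebraMap_eq, Matrix.mul_apply, Finset.mul_sum, Finset.sum_mul]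
  rw [Finset.sum_comm]
  refine Finset.sum_congr rfl fun k _ => Finset.sum_congr rfl fun l _ => ?_
  ring

theorem linearSubst_one (p : MvPolynomial (Fin d) ℂ) : linearSubst 1 p = p := by
  suffices linearSubst (1 : Matrix (Fin d) (Fin d) ℂ) = AlgHom.id ℂ _ from
    DFunLike.congr_fun this p
  refine MvPolynomial.algHom_ext fun j => ?_
  simp [linearSubst_X, Matrix.one_apply, apply_ite MvPolynomial.C]

end LinearChange

/-! ### Topology of the unitary group -/

section UnitaryGroup

variable {d : ℕ}

theorem isClosed_unitaryGroup :
    IsClosed (Matrix.unitaryGroup (Fin d) ℂ : Set (Matrix (Fin d) (Fin d) ℂ)) := by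
  have : (Matrix.unitaryGroup (Fin d) ℂ : Set (Matrix (Fin d) (Fin d) ℂ)) =
      {A | A * star A = 1} := by
    ext A
    exact Matrix.mem_unitaryGroup_iff
  rw [this]
  exact isClosed_eq (by fun_prop) continuous_const

instance compactSpace_unitaryGroup : CompactSpace (Matrix.unitaryGroup (Fin d) ℂ) := by
  refine isCompact_iff_compactSpace.1 (IsCompact.of_isClosed_subset
    (isCompact_univ_pi fun _ : Fin d => isCompact_univ_pi fun _ : Fin d =>
      isCompact_closedBall (0 : ℂ) 1) isClosed_unitaryGroup ?_)
  intro A hA i _ j _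
  simpa using entry_norm_bound_of_unitary hA i j

instance secondCountableTopology_matrix :
    SecondCountableTopology (Matrix (Fin d) (Fin d) ℂ) :=
  inferInstanceAs (SecondCountableTopology (Fin d → Fin d → ℂ))

instance secondCountableTopology_unitaryGroup :
    SecondCountableTopology (Matrix.unitaryGroup (Fin d) ℂ) :=
  TopologicalSpace.Subtype.secondCountableTopology _

theorem continuous_unitaryGroup_entry (j k : Fin d) :
    Continuous fun a : Matrix.unitaryGroup (Fin d) ℂ => (a : Matrix (Fin d) (Fin d) ℂ) j k :=
  continuous_subtype_val.matrix_elem j k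

end UnitaryGroup

/-! ### Polynomials inside the function space -/

section Polynomials

variable {d : ℕ} {H : Type u} [NormedAddCommGroup H] [InnerProductSpace ℂ H] [CompleteSpace H]
  [RKHS ℂ H (UnitBall d) ℂ]

theorem HasHomDecomposition.exists_poly (hdec : HasHomDecomposition d H)
    (p : MvPolynomial (Fin d) ℂ) : ∃ f : H, ∀ z, f z = polyVal p z := by
  rw [← MvPolynomial.sum_homogeneousComponent p]
  choose F hF using fun n => hdec.exists_of_isHomogeneous n _
    (MvPolynomial.homogeneousComponent_isHomogeneous n p)
  refine ⟨∑ n ∈ Finset.range (p.totalDegree + 1), F n, fun z => ?_⟩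
  have h : ∀ s : Finset ℕ, (∑ n ∈ s, F n : H) z = ∑ n ∈ s, F n z := fun s => by
    have := congr_fun (map_sum (RKHS.coeCLM ℂ (H := H)) F s) z
    rwa [Finset.sum_apply] at this
  rw [h]
  simp [polyVal, hF]

/-- The linear map sending a polynomial to its restriction to the ball, as an element of `H`. -/
noncomputable def polyElem (hdec : HasHomDecomposition d H) : MvPolynomial (Fin d) ℂ →ₗ[ℂ] H where
  toFun p := Classical.choose (hdec.exists_poly p)
  map_add' p q := RKHS.ext fun z => by
    have h := fun r => Classical.choose_spec (hdec.exists_poly r) z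
    rw [RKHS.coe_add, Pi.add_apply]
    exact (h (p + q)).trans ((map_add _ p q).trans (congrArg₂ (· + ·) (h p).symm (h q).symm))
  map_smul' c p := RKHS.ext fun z => by
    have h := fun r => Classical.choose_spec (hdec.exists_poly r) z
    rw [RingHom.id_apply, RKHS.coe_smul, Pi.smul_apply]
    exact (h (c • p)).trans ((MvPolynomial.smul_eval _ p c).trans (congrArg (c * ·) (h p).symm))

variable (hdec : HasHomDecomposition d H) (hMz : CoordInvariant d H)

theorem polyElem_apply (p : MvPolynomial (Fin d) ℂ) (z : UnitBall d) :
    polyElem hdec p z = polyVal p z :=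
  Classical.choose_spec (hdec.exists_poly p) z

theorem polyElem_mem_homSubspace {n : ℕ} {p : MvPolynomial (Fin d) ℂ} (hp : p.IsHomogeneous n) :
    polyElem hdec p ∈ homSubspace d H n :=
  ⟨p, hp, polyElem_apply hdec p⟩

theorem polyElem_mul_X (p : MvPolynomial (Fin d) ℂ) (j : Fin d) :
    polyElem hdec (p * MvPolynomial.X j) = coordMul hMz j (polyElem hdec p) :=
  RKHS.ext fun z => by simp [polyElem_apply, coordMul_apply, polyVal, mul_comm]

theorem polyElem_C (c : ℂ) :
    polyElem hdec (MvPolynomial.C c) = c • polyElem hdec 1 := by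
  rw [← map_smul, MvPolynomial.smul_eq_C_mul, mul_one]

theorem coordMul_comm (i j : Fin d) : Commute (coordMul hMz i) (coordMul hMz j) :=
  ContinuousLinearMap.ext fun f => RKHS.ext fun z => by
    simp [coordMul_apply, mul_left_comm]

/-- Finite partial sums of the expansion into homogeneous components are polynomials. -/
theorem denseRange_polyElem : DenseRange (polyElem hdec) := by
  intro f
  obtain ⟨g, rfl⟩ := hdec.isHilbertSum.surjective_isometry f
  refine mem_closure_of_tendsto (hdec.isHilbertSum.OrthogonalFamily.hasSum_linearIsometry g)
    (Filter.Eventually.of_forall fun s => ?_)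
  rw [← LinearMap.coe_range]
  refine Submodule.sum_mem _ fun n _ => ?_
  obtain ⟨p, -, hp⟩ := (g n).2
  exact ⟨p, RKHS.ext fun z => (polyElem_apply hdec p z).trans (hp z).symm⟩

theorem inner_polyElem_eq_zero {m n : ℕ} (hmn : m ≠ n) {p q : MvPolynomial (Fin d) ℂ}
    (hp : p.IsHomogeneous m) (hq : q.IsHomogeneous n) :
    inner ℂ (polyElem hdec p) (polyElem hdec q) = 0 :=
  hdec.isHilbertSum.OrthogonalFamily hmn ⟨_, polyElem_mem_homSubspace hdec hp⟩
    ⟨_, polyElem_mem_homSubspace hdec hq⟩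

theorem norm_polyElem_sq (p : MvPolynomial (Fin d) ℂ) :
    ‖polyElem hdec p‖ ^ 2 = ∑ n ∈ Finset.range (p.totalDegree + 1),
      ‖polyElem hdec (MvPolynomial.homogeneousComponent n p)‖ ^ 2 := by
  conv_lhs => rw [← MvPolynomial.sum_homogeneousComponent p, map_sum]
  exact hdec.isHilbertSum.OrthogonalFamily.norm_sum (fun n => ⟨_, polyElem_mem_homSubspace hdec
    (MvPolynomial.homogeneousComponent_isHomogeneous n p)⟩) _

theorem norm_polyElem_linearSubst_sq (a : Matrix (Fin d) (Fin d) ℂ)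
    (p : MvPolynomial (Fin d) ℂ) :
    ‖polyElem hdec (linearSubst a p)‖ ^ 2 = ∑ n ∈ Finset.range (p.totalDegree + 1),
      ‖polyElem hdec (linearSubst a (MvPolynomial.homogeneousComponent n p))‖ ^ 2 := by
  conv_lhs => rw [← MvPolynomial.sum_homogeneousComponent p, map_sum, map_sum]
  exact hdec.isHilbertSum.OrthogonalFamily.norm_sum (fun n => ⟨_, polyElem_mem_homSubspace hdec
    (linearSubst_isHomogeneous a (MvPolynomial.homogeneousComponent_isHomogeneous n p))⟩) _

/-- Multiplication by a polynomial is a bounded operator on `H`. -/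
theorem exists_polyMul (hMz : CoordInvariant d H) (q : MvPolynomial (Fin d) ℂ) :
    ∃ L : H →L[ℂ] H, ∀ f z, L f z = polyVal q z * f z := by
  induction q using MvPolynomial.induction_on with
  | C c => exact ⟨c • ContinuousLinearMap.id ℂ H, fun f z => by simp [polyVal]⟩
  | add p q hp hq =>
    obtain ⟨L, hL⟩ := hp
    obtain ⟨M, hM⟩ := hq
    exact ⟨L + M, fun f z => by simp [hL, hM, polyVal, add_mul]⟩
  | mul_X p j hp =>
    obtain ⟨L, hL⟩ := hp
    exact ⟨L ∘L coordMul hMz j, fun f z => by simp [hL, coordMul_apply, polyVal, mul_assoc]⟩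

/-- The centre of the unit ball. -/
def ballCentre (d : ℕ) : UnitBall d := ⟨0, by simp⟩

theorem polyVal_ballCentre {n : ℕ} (hn : n ≠ 0) {p : MvPolynomial (Fin d) ℂ}
    (hp : p.IsHomogeneous n) : polyVal p (ballCentre d) = 0 := by
  have : (fun i => (ballCentre d).1 i) = 0 := by ext i; simp [ballCentre]
  rw [polyVal, this, MvPolynomial.eval_zero, MvPolynomial.constantCoeff_eq]
  exact hp.coeff_eq_zero (by simpa using hn.symm)

theorem ext_polyElem {E : Type*} [TopologicalSpace E] [T2Space E] {φ ψ : H → E}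
    (hφ : Continuous φ) (hψ : Continuous ψ)
    (h : ∀ p, φ (polyElem hdec p) = ψ (polyElem hdec p)) (f : H) : φ f = ψ f :=
  congr_fun ((denseRange_polyElem hdec).equalizer hφ hψ (funext h)) f

theorem ext_homogeneous {φ ψ : H →L[ℂ] ℂ}
    (h : ∀ n (p : MvPolynomial (Fin d) ℂ), p.IsHomogeneous n →
      φ (polyElem hdec p) = ψ (polyElem hdec p)) (f : H) : φ f = ψ f := by
  refine ext_polyElem hdec φ.continuous ψ.continuous (fun p => ?_) f
  rw [← MvPolynomial.sum_homogeneousComponent p]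
  simp only [map_sum]
  exact Finset.sum_congr rfl fun n _ =>
    h n _ (MvPolynomial.homogeneousComponent_isHomogeneous n p)

/-- If `q` is homogeneous, the component of `q h` along `q` only sees the value of `h` at the
centre of the ball. -/
theorem inner_polyElem_polyMul {n : ℕ} {q : MvPolynomial (Fin d) ℂ} (hq : q.IsHomogeneous n)
    {L : H →L[ℂ] H} (hL : ∀ f z, L f z = polyVal q z * f z) (h : H) :
    inner ℂ (polyElem hdec q) (L h) = h (ballCentre d) * (‖polyElem hdec q‖ : ℂ) ^ 2 := by
  let ev : H →L[ℂ] ℂ := (ContinuousLinearMap.proj (ballCentre d)) ∘L RKHS.coeCLM ℂ (H := H)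
  have key := ext_homogeneous hdec (φ := (innerSL ℂ (polyElem hdec q)) ∘L L)
    (ψ := ((‖polyElem hdec q‖ : ℂ) ^ 2) • ev) (fun m p hp => ?_) h
  · simpa [ev, mul_comm] using key
  · have h1 : L (polyElem hdec p) = polyElem hdec (q * p) :=
      RKHS.ext fun z => by simp [hL, polyElem_apply, polyVal]
    have h2 : ev (polyElem hdec p) = polyVal p (ballCentre d) := polyElem_apply hdec p _
    simp only [ContinuousLinearMap.comp_apply, innerSL_apply_apply, h1,
      smul_apply, h2]
    -- For `m ≠ 0` the product `q * p` has degree `n + m ≠ n`, hence is orthogonal to `q`; only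
    -- constants contribute.
    rcases eq_or_ne m 0 with rfl | hm
    · rw [MvPolynomial.totalDegree_eq_zero_iff_eq_C.1
        ((MvPolynomial.totalDegree_zero_iff_isHomogeneous _).2 hp), mul_comm q,
        ← MvPolynomial.smul_eq_C_mul]
      simp [polyVal, inner_smul_right, mul_comm]
    · rw [polyVal_ballCentre hm hp, smul_zero]
      exact inner_polyElem_eq_zero hdec (by omega) hq (hq.mul hp)

end Polynomials

/-! ### Bounds for composition with unitaries -/

section Bounds

variable {d : ℕ} {H : Type u} [NormedAddCommGroup H] [InnerProductSpace ℂ H] [CompleteSpace H]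
  [RKHS ℂ H (UnitBall d) ℂ] (hdec : HasHomDecomposition d H) {hMz : CoordInvariant d H}

/-- Each use of the intertwining relation trades a factor `z_j` for `(a z)_j`, so `Γ` is determined
on polynomials by `Γ 1`. -/
theorem intertwiner_polyElem_apply {a : Matrix.unitaryGroup (Fin d) ℂ} {Γ : H ≃L[ℂ] H}
    (hΓ : ∀ j f, Γ (coordMul hMz j f) = unitaryAct a (coordMul hMz) j (Γ f))
    (p : MvPolynomial (Fin d) ℂ) {L : H →L[ℂ] H}
    (hL : ∀ f z, L f z = polyVal (linearSubst a p) z * f z) :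
    Γ (polyElem hdec p) = L (Γ (polyElem hdec 1)) := by
  induction p using MvPolynomial.induction_on generalizing L with
  | C c =>
    rw [polyElem_C, map_smul]
    exact RKHS.ext fun z => by simp [hL, polyVal]
  | add p q hp hq =>
    obtain ⟨P, hP⟩ := exists_polyMul hMz (linearSubst a p)
    obtain ⟨Q, hQ⟩ := exists_polyMul hMz (linearSubst a q)
    rw [map_add, map_add, hp hP, hq hQ]
    exact RKHS.ext fun z => by simp [hL, hP, hQ, polyVal, add_mul]
  | mul_X p j hp =>
    obtain ⟨P, hP⟩ := exists_polyMul hMz (linearSubst a p)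
    rw [polyElem_mul_X hdec hMz, hΓ, hp hP]
    have h : ∀ f z, unitaryAct a (coordMul hMz) j f z =
        polyVal (linearSubst a (MvPolynomial.X j)) z * f z := fun f z => by
      have := congr_fun (map_sum (RKHS.coeCLM ℂ (H := H))
        (fun k => (a : Matrix (Fin d) (Fin d) ℂ) j k • coordMul hMz k f) Finset.univ) z
      rw [Finset.sum_apply] at this
      simp only [unitaryAct, sum_apply, smul_apply]
      refine this.trans ?_
      simp [linearSubst_X, polyVal, coordMul_apply, Finset.sum_mul, mul_assoc]
    exact RKHS.ext fun z => by simp only [h, hL, hP, polyVal, map_mul]; ring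

theorem unitaryAct_ballCentre (a : Matrix.unitaryGroup (Fin d) ℂ) (j : Fin d) (f : H) :
    unitaryAct a (coordMul hMz) j f (ballCentre d) = 0 := by
  have := congr_fun (map_sum (RKHS.coeCLM ℂ (H := H))
    (fun k => (a : Matrix (Fin d) (Fin d) ℂ) j k • coordMul hMz k f) Finset.univ) (ballCentre d)
  rw [Finset.sum_apply] at this
  simp only [unitaryAct, sum_apply, smul_apply]
  refine this.trans (Finset.sum_eq_zero fun k _ => ?_)
  simp [coordMul_apply, ballCentre]

/-- `Γ` sends multiples of `z_j` to functions vanishing at the centre, so evaluation there after `Γ`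
only sees constant terms. -/
theorem intertwiner_ballCentre {a : Matrix.unitaryGroup (Fin d) ℂ} {Γ : H ≃L[ℂ] H}
    (hΓ : ∀ j f, Γ (coordMul hMz j f) = unitaryAct a (coordMul hMz) j (Γ f)) (f : H) :
    Γ f (ballCentre d) = f (ballCentre d) * Γ (polyElem hdec 1) (ballCentre d) := by
  refine ext_polyElem hdec (φ := fun f => Γ f (ballCentre d))
    (ψ := fun f => f (ballCentre d) * Γ (polyElem hdec 1) (ballCentre d))
    ((RKHS.continuous_eval _).comp Γ.continuous)
    ((RKHS.continuous_eval _).mul continuous_const) (fun p => ?_) f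
  induction p using MvPolynomial.induction_on with
  | C c => simp [polyElem_C, polyElem_apply hdec 1, polyVal]
  | add p q hp hq => simp [hp, hq, add_mul]
  | mul_X p j hp =>
    rw [polyElem_mul_X hdec hMz, hΓ, unitaryAct_ballCentre, coordMul_apply]
    simp [ballCentre]

/-- Otherwise everything in the range of `Γ` would vanish at the centre, but `1` is in the range. -/
theorem intertwiner_one_ballCentre_ne_zero {a : Matrix.unitaryGroup (Fin d) ℂ} {Γ : H ≃L[ℂ] H}
    (hΓ : ∀ j f, Γ (coordMul hMz j f) = unitaryAct a (coordMul hMz) j (Γ f)) :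
    Γ (polyElem hdec 1) (ballCentre d) ≠ 0 := by
  intro h
  have := intertwiner_ballCentre hdec hΓ (Γ.symm (polyElem hdec 1))
  rw [h, mul_zero, ContinuousLinearEquiv.apply_symm_apply, polyElem_apply] at this
  simp [polyVal] at this

/-- Cauchy–Schwarz for `p ∘ a` against `Γ p`. The constant does not depend on the degree, which lets
it pass to sums of components. -/
theorem exists_bound_linearSubst_of_isHomogeneous (hw : IsWeaklyHomogeneous (coordMul hMz))
    (a : Matrix.unitaryGroup (Fin d) ℂ) :
    ∃ C : ℝ, 0 ≤ C ∧ ∀ n (p : MvPolynomial (Fin d) ℂ), p.IsHomogeneous n →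
      ‖polyElem hdec (linearSubst a p)‖ ≤ C * ‖polyElem hdec p‖ := by
  obtain ⟨Γ, hΓ⟩ := hw.2 a
  obtain ⟨c, hc⟩ : ∃ c, Γ (polyElem hdec 1) (ballCentre d) = c := ⟨_, rfl⟩
  have hc0 : 0 < ‖c‖ := by
    rw [← hc]
    exact norm_pos_iff.2 (intertwiner_one_ballCentre_ne_zero hdec hΓ)
  obtain ⟨G, hG0, hG⟩ : ∃ G : ℝ, 0 ≤ G ∧ ∀ f, ‖Γ f‖ ≤ G * ‖f‖ :=
    ⟨_, norm_nonneg _, (Γ : H →L[ℂ] H).le_opNorm⟩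
  refine ⟨G / ‖c‖, by positivity, fun n p hp => ?_⟩
  obtain ⟨L, hL⟩ := exists_polyMul hMz (linearSubst a p)
  have hq := linearSubst_isHomogeneous (a : Matrix (Fin d) (Fin d) ℂ) hp
  have h1 := inner_polyElem_polyMul hdec hq hL (Γ (polyElem hdec 1))
  rw [← intertwiner_polyElem_apply hdec hΓ p hL, hc] at h1
  have h2 := norm_inner_le_norm (𝕜 := ℂ) (polyElem hdec (linearSubst a p)) (Γ (polyElem hdec p))
  rw [h1, norm_mul, norm_pow, Complex.norm_real, norm_norm] at h2
  rw [div_mul_eq_mul_div, le_div_iff₀ hc0]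
  refine le_trans ?_ (hG _)
  rcases (norm_nonneg (polyElem hdec (linearSubst a p))).eq_or_lt with h0 | h0
  · rw [← h0, zero_mul]
    exact norm_nonneg _
  · refine le_of_mul_le_mul_left (le_trans (le_of_eq ?_) h2) h0
    ring

theorem exists_bound_linearSubst (hw : IsWeaklyHomogeneous (coordMul hMz))
    (a : Matrix.unitaryGroup (Fin d) ℂ) :
    ∃ C : ℝ, 0 ≤ C ∧ ∀ p, ‖polyElem hdec (linearSubst a p)‖ ≤ C * ‖polyElem hdec p‖ := by
  obtain ⟨C, hC, hom⟩ := exists_bound_linearSubst_of_isHomogeneous hdec hw a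
  refine ⟨C, hC, fun p => le_of_sq_le_sq ?_ (by positivity)⟩
  rw [mul_pow, norm_polyElem_linearSubst_sq, norm_polyElem_sq, Finset.mul_sum]
  refine Finset.sum_le_sum fun n _ => ?_
  rw [← mul_pow]
  exact pow_le_pow_left₀ (norm_nonneg _)
    (hom n _ (MvPolynomial.homogeneousComponent_isHomogeneous n p)) 2

theorem polyElem_linearSubst_mul_X (hMz : CoordInvariant d H) (a : Matrix.unitaryGroup (Fin d) ℂ)
    (p : MvPolynomial (Fin d) ℂ) (j : Fin d) :
    polyElem hdec (linearSubst a (p * MvPolynomial.X j)) =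
      unitaryAct a (coordMul hMz) j (polyElem hdec (linearSubst a p)) := by
  rw [map_mul, linearSubst_X, Finset.mul_sum, map_sum]
  simp only [unitaryAct, sum_apply, smul_apply]
  refine Finset.sum_congr rfl fun k _ => ?_
  rw [← polyElem_mul_X, ← map_smul, MvPolynomial.smul_eq_C_mul]
  congr 1
  ring

theorem continuous_polyElem_linearSubst (hMz : CoordInvariant d H)
    (p : MvPolynomial (Fin d) ℂ) :
    Continuous fun a : Matrix.unitaryGroup (Fin d) ℂ => polyElem hdec (linearSubst a p) := by
  induction p using MvPolynomial.induction_on with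
  | C c => simpa [linearSubst] using continuous_const
  | add p q hp hq => simpa only [map_add] using Continuous.fun_add hp hq
  | mul_X p j hp =>
    simp only [polyElem_linearSubst_mul_X hdec hMz, unitaryAct, sum_apply,
      smul_apply]
    exact continuous_finsetSum _ fun k _ =>
      (continuous_unitaryGroup_entry j k).smul ((coordMul hMz k).continuous.comp hp)

theorem exists_uniform_bound_linearSubst (hw : IsWeaklyHomogeneous (coordMul hMz)) :
    ∃ C : ℝ, ∀ (a : Matrix.unitaryGroup (Fin d) ℂ) p,
      ‖polyElem hdec (linearSubst a p)‖ ≤ C * ‖polyElem hdec p‖ := by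
  choose c hc0 hc using exists_bound_linearSubst hdec hw
  let F : ℕ → Set (Matrix.unitaryGroup (Fin d) ℂ) := fun N =>
    {a | ∀ p, ‖polyElem hdec (linearSubst a p)‖ ≤ N * ‖polyElem hdec p‖}
  have hF : ∀ N, IsClosed (F N) := fun N => by
    simp only [F, Set.ofPred_forall]
    exact isClosed_iInter fun p =>
      isClosed_le (continuous_polyElem_linearSubst hdec hMz p).norm continuous_const
  have hU : ⋃ N, F N = Set.univ := by
    refine Set.eq_univ_of_forall fun a => ?_
    obtain ⟨N, hN⟩ := exists_nat_ge (c a)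
    refine Set.mem_iUnion.2 ⟨N, fun p => (hc a p).trans ?_⟩
    gcongr
  -- Baire: some uniform bound `N` holds on an open set, finitely many translates of which cover the
  -- group.
  obtain ⟨N, hN⟩ := nonempty_interior_of_iUnion_of_closed hF hU
  obtain ⟨t, ht⟩ := compact_covered_by_mul_left_translates isCompact_univ hN
  refine ⟨(∑ g ∈ t, c g⁻¹) * N, fun a p => ?_⟩
  obtain ⟨g, hg, hga⟩ := Set.mem_iUnion₂.1 (ht (Set.mem_univ a))
  -- Factor substitution by `a` through `g⁻¹`, one of finitely many, and `g * a`, which lies in `F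
  -- N`.
  have h1 := hga (linearSubst (g⁻¹ : Matrix.unitaryGroup (Fin d) ℂ) p)
  have h2 : linearSubst ((g * a : Matrix.unitaryGroup (Fin d) ℂ) : Matrix (Fin d) (Fin d) ℂ)
      (linearSubst (g⁻¹ : Matrix.unitaryGroup (Fin d) ℂ) p) = linearSubst a p := by
    rw [linearSubst_linearSubst, ← Submonoid.coe_mul, inv_mul_cancel_left]
  rw [h2] at h1
  have h3 : c g⁻¹ ≤ ∑ g ∈ t, c g⁻¹ :=
    Finset.single_le_sum (f := fun g => c g⁻¹) (fun g _ => hc0 g⁻¹) hg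
  calc _ ≤ N * (c g⁻¹ * ‖polyElem hdec p‖) := h1.trans (by gcongr; exact hc g⁻¹ p)
    _ ≤ N * ((∑ g ∈ t, c g⁻¹) * ‖polyElem hdec p‖) := by gcongr
    _ = _ := by ring

theorem exists_composition (hw : IsWeaklyHomogeneous (coordMul hMz)) :
    ∃ (C : Matrix.unitaryGroup (Fin d) ℂ → H →L[ℂ] H) (M : ℝ),
      (∀ a p, C a (polyElem hdec p) = polyElem hdec (linearSubst a p)) ∧
        ∀ a f, ‖C a f‖ ≤ M * ‖f‖ := by
  obtain ⟨M, hM⟩ := exists_uniform_bound_linearSubst hdec hw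
  refine ⟨fun a => (polyElem hdec ∘ₗ
    (linearSubst (a : Matrix (Fin d) (Fin d) ℂ)).toLinearMap).extendOfNorm (polyElem hdec), M,
    fun a p => ?_, fun a f => ?_⟩
  · exact LinearMap.extendOfNorm_eq (denseRange_polyElem hdec) ⟨M, hM a⟩ p
  · exact LinearMap.norm_extendOfNorm_apply_le (denseRange_polyElem hdec) M (hM a) f

end Bounds

/-! ### The two implications -/

theorem IsSimilarToHomogeneous.isWeaklyHomogeneous {d : ℕ} {H : Type u} [NormedAddCommGroup H]
    [InnerProductSpace ℂ H] {T : Fin d → H →L[ℂ] H}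
    (hT : ∀ i j, Commute (T i) (T j)) (h : IsSimilarToHomogeneous T) : IsWeaklyHomogeneous T := by
  obtain ⟨K, _, _, _, R, hR, S, hS⟩ := h
  refine ⟨hT, fun a => ?_⟩
  obtain ⟨U, hU⟩ := hR.2 a
  refine ⟨(S.trans U.toContinuousLinearEquiv).trans S.symm, fun j f => ?_⟩
  have h1 : ∀ x, S (unitaryAct a T j x) = unitaryAct a R j (S x) := fun x => by
    simp [unitaryAct, hS]
  apply S.injective
  simp [h1, hS, hU]

theorem theorem2p4 {d : ℕ} {H : Type u} [NormedAddCommGroup H] [InnerProductSpace ℂ H]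
    [CompleteSpace H] [RKHS ℂ H (UnitBall d) ℂ]
    (hhol : ∀ f : H, IsHolomorphicOnBall (fun z : UnitBall d => f z))
    (hdec : HasHomDecomposition d H) (hMz : CoordInvariant d H) :
    IsWeaklyHomogeneous (coordMul hMz) ↔ IsSimilarToHomogeneous (coordMul hMz) := by
  refine ⟨fun hw => ?_, fun h => h.isWeaklyHomogeneous (coordMul_comm hMz)⟩
  obtain ⟨C, M, hC, hM⟩ := exists_composition hdec hw
  have hmul : ∀ a b f, C a (C b f) = C (b * a) f := fun a b f =>
    ext_polyElem hdec (φ := fun f => C a (C b f)) (by fun_prop) (C (b * a)).continuous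
      (fun p => by simp [hC, linearSubst_linearSubst]) f
  have hone : ∀ f, C 1 f = f := fun f =>
    ext_polyElem hdec (C 1).continuous continuous_id (fun p => by simp [hC, linearSubst_one]) f
  -- The uniform bound makes each orbit map a uniform limit of orbit maps of polynomials, which are
  -- continuous.
  have hcont : ∀ f, Continuous fun a => C a f := fun f => by
    refine continuous_of_uniform_approx_of_continuous fun u hu => ?_
    obtain ⟨ε, hε, hεu⟩ := Metric.mem_uniformity_dist.1 hu
    obtain ⟨p, hp⟩ := (denseRange_polyElem hdec).exists_dist_lt f
      (show 0 < ε / (|M| + 1) by positivity)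
    refine ⟨fun a => C a (polyElem hdec p), ?_, fun a => hεu ?_⟩
    · simpa only [hC] using continuous_polyElem_linearSubst hdec hMz p
    · rw [dist_eq_norm, ← map_sub]
      rw [dist_eq_norm, lt_div_iff₀ (by positivity)] at hp
      refine lt_of_le_of_lt ((hM a _).trans ?_) hp
      rw [mul_comm]
      gcongr
      linarith [le_abs_self M]
  have hint : ∀ a j f, C a (coordMul hMz j f) = unitaryAct a (coordMul hMz) j (C a f) :=
    fun a j f => ext_polyElem hdec (φ := fun f => C a (coordMul hMz j f))
      (ψ := fun f => unitaryAct a (coordMul hMz) j (C a f)) (by fun_prop) (by fun_prop)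
      (fun p => by
        simp only [← polyElem_mul_X, hC]
        rw [polyElem_linearSubst_mul_X hdec hMz]) f
  obtain ⟨K, _, _, _, S, hS⟩ := exists_equiv_forall_norm_eq C hmul hone hcont hM
  let R : Fin d → K →L[ℂ] K := fun j => S ∘L coordMul hMz j ∘L S.symm
  have hSR : ∀ j f, S (coordMul hMz j f) = R j (S f) := fun j f => by simp [R]
  refine ⟨K, inferInstance, inferInstance, inferInstance, R, ⟨fun i j => ?_, fun a => ?_⟩, S, hSR⟩
  · refine ContinuousLinearMap.ext fun x => ?_
    have := DFunLike.congr_fun (coordMul_comm hMz i j).eq (S.symm x)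
    simpa [R] using this
  · let U : K ≃ₗ[ℂ] K :=
      { (S ∘L C a ∘L S.symm : K →L[ℂ] K).toLinearMap with
        invFun := fun x => S (C a⁻¹ (S.symm x))
        left_inv := fun x => by simp [hmul, hone]
        right_inv := fun x => by simp [hmul, hone] }
    refine ⟨⟨U, fun x => (hS a (S.symm x)).trans (by simp)⟩, fun j x => ?_⟩
    have h1 : ∀ f, S (unitaryAct a (coordMul hMz) j f) = unitaryAct a R j (S f) := fun f => by
      simp [unitaryAct, hSR]
    change S (C a (S.symm (R j x))) = unitaryAct a R j (S (C a (S.symm x)))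
    rw [← h1, ← hint]
    simp [R]
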